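/- A \emph{network} is a finite directed acyclic multigraph together with finitely many messages; each message is generated at one node and is demanded by one or more nodes. A $(k,n)$ \emph{coding solution} over a finite alphabet $\mathcal A$ with $|\mathcal A|\ge 2$ (where $k,n\ge 1$) assigns to every edge a function computing a vector in $\mathcal A^n$, and to every demand at a node a function computing a vector in $\mathcal A^k$, from the inputs of the relevant node (for an edge, its tail), namely the vectors in $\mathcal A^n$ carried by the in-edges of the node and the messages in $\mathcal A^k$ generated at it, in such a way that for all values of the messages every demanded message is computed correctly. The solution is \emph{linear} if $\mathcal A$ is a finite field and all these functions are linear. The \emph{coding capacity} (over $\mathcal A$) is $\sup\{k/n : \text{a } (k,n) \text{ coding solution over } \mathcal A \text{ exists}\}$, and the \emph{linear coding capacity} over a finite field $F$ is the same supremum restricted to linear solutions over $F$. The \emph{T8 network} has messages $A,B,C,D$, generated at four separate source nodes $s_A,s_B,s_C,s_D$, further nodes $n_1,\dots,n_{15}$, and the following edges: \begin{itemize} \item from $s_A,s_B,s_C$ to $n_1$; from $s_B,s_C,s_D$ to $n_3$; from $s_A,s_C,s_D$ to $n_5$; \item $(n_1,n_2)$, $(n_3,n_4)$, $(n_5,n_6)$;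 from $n_2,n_4,n_6$ to $n_7$; $(n_7,n_8)$; \item from $s_B,s_D,n_8$ to $n_9$; from $s_A,n_4,n_2$ to $n_{10}$; from $s_D,n_8,n_2$ to $n_{11}$; from $s_D,n_6,n_2$ to $n_{12}$; from $s_B,n_6,n_8$ to $n_{13}$; from $s_A,n_4,n_8$ to $n_{14}$; from $s_A,n_4,n_6$ to $n_{15}$. \end{itemize} The nodes $n_9,n_{10},n_{11},n_{12},n_{13},n_{14},n_{15}$ demand $A,D,C,B,C,C,B$ respectively, and there are no other demands. \textbf{Corollary.} For the T8 network: \begin{enumerate} \item the linear coding capacity over every finite field of characteristic different from $3$ is at most $48/49$; \item the linear coding capacity over every finite field of characteristic $3$ equals $1$; \item the coding capacity equals $1$, both over every fixed finite alphabet with at least two symbols and when the supremum is taken over all such alphabets. \end{enumerate} -/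

import Mathlib

open scoped ENNReal

/-- A network: a finite, directed, acyclic multigraph with messages and demands.
Every message originates at one node and is demanded by at least one node. -/
structure Network where
  Node : Type
  Edge : Type
  Msg : Type
  finite_node : Finite Node
  finite_edge : Finite Edge
  finite_msg : Finite Msg
  tail : Edge → Node
  head : Edge → Node
  source : Msg → Node
  demand : Node → Set Msg
  acyclic : ∀ v, ¬ Relation.TransGen (fun u w => ∃ e, tail e = u ∧ head e = w) v v
  demanded : ∀ m, ∃ v, m ∈ demand v

namespace Network

/-- The in-edges of a node. -/
abbrev InEdge (N : Network) (v : N.Node) : Type := {e : N.Edge // N.head e = v}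

/-- The messages generated at a node. -/
abbrev MsgAt (N : Network) (v : N.Node) : Type := {m : N.Msg // N.source m = v}

/-- The inputs of the node `v`: a vector of `n` symbols for every in-edge, and a vector of `k`
symbols for every message generated at `v`. -/
abbrev Inputs (N : Network) (𝒜 : Type*) (k n : ℕ) (v : N.Node) : Type _ :=
  (N.InEdge v → Fin n → 𝒜) × (N.MsgAt v → Fin k → 𝒜)

/-- A `(k, n)` code over the alphabet `𝒜`: every output of a node (the vector on an out-edge, or a
demanded message) is assigned a function of the inputs of that node. -/
structure Code (N : Network) (𝒜 : Type*) (k n : ℕ) where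
  edgeFn : ∀ e : N.Edge, N.Inputs 𝒜 k n (N.tail e) → Fin n → 𝒜
  decodeFn : ∀ (v : N.Node) (m : N.Msg), m ∈ N.demand v → N.Inputs 𝒜 k n v → Fin k → 𝒜

/-- The inputs seen at the node `v` when the messages are `x` and the edges carry `w`. -/
def inputsAt (N : Network) {𝒜 : Type*} {k n : ℕ} (x : N.Msg → Fin k → 𝒜)
    (w : N.Edge → Fin n → 𝒜) (v : N.Node) : N.Inputs 𝒜 k n v :=
  (fun e => w e.1, fun m => x m.1)

namespace Code

variable {N : Network} {𝒜 : Type*} {k n : ℕ}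

/-- `w` is what the edges carry under the code `c` when the messages are `x`. -/
def Carries (c : N.Code 𝒜 k n) (x : N.Msg → Fin k → 𝒜) (w : N.Edge → Fin n → 𝒜) : Prop :=
  ∀ e, w e = c.edgeFn e (N.inputsAt x w (N.tail e))

/-- `c` is a coding solution: for all values of the messages, every demand is met.
(As the network is acyclic, the edge vectors `w` carried for the messages `x` exist and are
unique.) -/
def IsSolution (c : N.Code 𝒜 k n) : Prop :=
  ∀ x : N.Msg → Fin k → 𝒜, ∃ w : N.Edge → Fin n → 𝒜, c.Carries x w ∧
    ∀ (v : N.Node) (m : N.Msg) (h : m ∈ N.demand v), c.decodeFn v m h (N.inputsAt x w v) = x m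

/-- All functions of the code are linear over the field `F`, jointly in the inputs. -/
def IsLinear {F : Type*} [Field F] (c : N.Code F k n) : Prop :=
  (∀ e, IsLinearMap F (c.edgeFn e)) ∧ ∀ v m h, IsLinearMap F (c.decodeFn v m h)

end Code

/-- The coding capacity over the alphabet `𝒜`: the supremum of `k / n` over all `(k, n)` coding
solutions over `𝒜`. The supremum is taken in `[0, ∞]`. -/
noncomputable def codingCapacityOver (N : Network) (𝒜 : Type*) : ℝ≥0∞ :=
  sSup {r | ∃ k n : ℕ, 0 < k ∧ 0 < n ∧ (∃ c : N.Code 𝒜 k n, c.IsSolution) ∧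
    r = (k : ℝ≥0∞) / (n : ℝ≥0∞)}

/-- The coding capacity, with the alphabet left free: the supremum of `k / n` over all `(k, n)`
coding solutions over all finite alphabets with at least two symbols. -/
noncomputable def codingCapacity (N : Network) : ℝ≥0∞ :=
  sSup {r | ∃ 𝒜 : Type, Finite 𝒜 ∧ Nontrivial 𝒜 ∧ ∃ k n : ℕ, 0 < k ∧ 0 < n ∧
    (∃ c : N.Code 𝒜 k n, c.IsSolution) ∧ r = (k : ℝ≥0∞) / (n : ℝ≥0∞)}

/-- The linear coding capacity over the field `F`: the supremum of `k / n` over all `(k, n)` linear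
solutions over `F`. -/
noncomputable def linearCapacityOver (N : Network) (F : Type*) [Field F] : ℝ≥0∞ :=
  sSup {r | ∃ k n : ℕ, 0 < k ∧ 0 < n ∧ (∃ c : N.Code F k n, c.IsLinear ∧ c.IsSolution) ∧
    r = (k : ℝ≥0∞) / (n : ℝ≥0∞)}

end Network

namespace T8

/-- The four messages. -/
inductive Msg
  | A | B | C | D
  deriving DecidableEq

open Msg in
instance : Fintype Msg where
  elems := {A, B, C, D}
  complete m := by cases m <;> decide

/-- The nodes: one source node `sA`, `sB`, `sC`, `sD` for each message, and `n1`, ..., `n15`. -/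
inductive Node
  | sA | sB | sC | sD
  | n1 | n2 | n3 | n4 | n5 | n6 | n7 | n8
  | n9 | n10 | n11 | n12 | n13 | n14 | n15
  deriving DecidableEq

open Node in
instance : Fintype Node where
  elems := {sA, sB, sC, sD, n1, n2, n3, n4, n5, n6, n7, n8, n9, n10, n11, n12, n13, n14, n15}
  complete v := by cases v <;> decide

open Node in
/-- The edges, as pairs (tail, head). The edges `(n1, n2)`, `(n3, n4)`, `(n5, n6)`, `(n7, n8)` are
those labelled `Z`, `W`, `X`, `Y`. -/
def edges : List (Node × Node) :=
  [ (sA, n1), (sB, n1), (sC, n1), (n1, n2),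
    (sB, n3), (sC, n3), (sD, n3), (n3, n4),
    (sA, n5), (sC, n5), (sD, n5), (n5, n6),
    (n4, n7), (n6, n7), (n2, n7), (n7, n8),
    (sB, n9), (sD, n9), (n8, n9),
    (sA, n10), (n4, n10), (n2, n10),
    (sD, n11), (n8, n11), (n2, n11),
    (sD, n12), (n6, n12), (n2, n12),
    (sB, n13), (n6, n13), (n8, n13),
    (sA, n14), (n4, n14), (n8, n14),
    (sA, n15), (n4, n15), (n6, n15) ]

/-- The node that generates a message. -/
def source : Msg → Node
  | .A => .sA
  | .B => .sB
  | .C => .sC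
  | .D => .sD

/-- The messages demanded by a node. -/
def demand : Node → Set Msg
  | .n9 => {.A}
  | .n10 => {.D}
  | .n11 => {.C}
  | .n12 => {.B}
  | .n13 => {.C}
  | .n14 => {.C}
  | .n15 => {.B}
  | _ => ∅

/-- Position in a topological order; used only to show that the network is acyclic. -/
def level : Node → ℕ
  | .sA | .sB | .sC | .sD => 0
  | .n1 | .n3 | .n5 => 1
  | .n2 | .n4 | .n6 => 2
  | .n7 => 3
  | .n8 => 4
  | _ => 5

theorem level_lt : ∀ p ∈ edges, level p.1 < level p.2 := by simp [edges, level]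

theorem level_lt_of_transGen {u v : Node}
    (h : Relation.TransGen
      (fun u w => ∃ e : {p : Node × Node // p ∈ edges}, e.1.1 = u ∧ e.1.2 = w) u v) :
    level u < level v := by
  induction h with
  | single h => obtain ⟨e, rfl, rfl⟩ := h; exact level_lt _ e.2
  | tail _ h ih => obtain ⟨e, rfl, rfl⟩ := h; exact ih.trans (level_lt _ e.2)

/-- The T8 network. -/
abbrev network : Network where
  Node := Node
  Edge := {p : Node × Node // p ∈ edges}
  Msg := Msg
  finite_node := inferInstance
  finite_edge := inferInstance
  finite_msg := inferInstance
  tail e := e.1.1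
  head e := e.1.2
  source := source
  demand := demand
  acyclic _ h := lt_irrefl _ (level_lt_of_transGen h)
  demanded m := by
    cases m
    · exact ⟨.n9, rfl⟩
    · exact ⟨.n12, rfl⟩
    · exact ⟨.n11, rfl⟩
    · exact ⟨.n10, rfl⟩

end T8

/-!
Everything that a solution on the T8 network does is visible on its four bottleneck edges, which
carry vectors `W`, `X`, `Y`, `Z`.

Over an abelian group in which `3 • g = 0`, the sums `W = B + C + D`, `X = A + C + D`,
`Z = A + B + C` and `Y = A + B + D = -(W + X + Z)` meet all demands. Over `ZMod 3`-linear alphabets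
this solves the network at rate `1`; any other alphabet embeds its blocks into a power of `ZMod 3`,
at the cost of a bounded number of extra symbols.

Conversely, for a linear solution put `δ = n - k`, and write `W b` for the value of `W` when `b` is
the only nonzero message. The demands force these values to align: all but `6 * δ` dimensions of
vectors `c` have partners `a`, `b`, `d` with `W b = W c = W d`, `X a = X c = X d` and
`Z a = Z b = Z c`, and all but `5 * δ` further dimensions also satisfy `Y a = Y b = Y d` and
`Y c = 0`. Then `a + b + d - 2 • c` is killed by `W`, `X`, `Z`, hence by `Y`, that is,
`3 • Y a = 0`. If `3 ≠ 0`, then all four vectors vanish, so `k ≤ 11 * δ`.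
-/

/-! ### Ratios of natural numbers -/

theorem natCast_div_le_natCast_div {a b c d : ℕ} (hd : 0 < d) (h : a * d ≤ c * b) :
    (a : ℝ≥0∞) / b ≤ c / d := by
  refine ENNReal.div_le_of_le_mul ?_
  rw [← ENNReal.mul_div_right_comm, ENNReal.le_div_iff_mul_le (by simp [hd.ne']) (by simp)]
  exact_mod_cast h

theorem natCast_div_le_one {k n : ℕ} (h : k ≤ n) : (k : ℝ≥0∞) / n ≤ 1 := by
  simpa using natCast_div_le_natCast_div (c := 1) one_pos (by lia)

theorem one_le_of_forall_natCast_div_le {s : ℝ≥0∞}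
    (h : ∀ k : ℕ, 0 < k → (k : ℝ≥0∞) / (k + 2 : ℕ) ≤ s) : 1 ≤ s := by
  have hlim := ENNReal.tendsto_ofReal (tendsto_natCast_div_add_atTop (2 : ℝ))
  rw [ENNReal.ofReal_one] at hlim
  refine le_of_tendsto hlim ((Filter.eventually_gt_atTop 0).mono fun k hk => ?_)
  rw [ENNReal.ofReal_div_of_pos (by positivity), ENNReal.ofReal_natCast]
  exact_mod_cast h k hk

/-! ### Linear algebra -/

section LinearAlgebra

open Module

variable {F P Q R : Type*} [Field F] [AddCommGroup P] [Module F P] [AddCommGroup Q] [Module F Q]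
  [AddCommGroup R] [Module F R]

theorem exists_linearMap_comp_eq_of_ker_le_ker {f : P →ₗ[F] Q} {g : P →ₗ[F] R}
    (h : LinearMap.ker f ≤ LinearMap.ker g) : ∃ l : Q →ₗ[F] R, l ∘ₗ f = g := by
  obtain ⟨r, hr⟩ := ((LinearMap.ker f).liftQ f le_rfl).exists_leftInverse_of_injective
    (Submodule.ker_liftQ_eq_bot _ _ _ le_rfl)
  refine ⟨(LinearMap.ker f).liftQ g h ∘ₗ r, LinearMap.ext fun x => ?_⟩
  have hrx : r (f x) = (LinearMap.ker f).mkQ x := LinearMap.congr_fun hr ((LinearMap.ker f).mkQ x)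
  simp only [LinearMap.comp_apply, hrx, Submodule.mkQ_apply, Submodule.liftQ_apply]

theorem finrank_le_sum_finrank_quotient [FiniteDimensional F P] {ι : Type*} [Fintype ι]
    {E : ι → Submodule F P} (hE : ⨅ i, E i = ⊥) : finrank F P ≤ ∑ i, finrank F (P ⧸ E i) := by
  rw [← finrank_pi_fintype F]
  refine LinearMap.finrank_le_finrank_of_injective (f := LinearMap.pi fun i => (E i).mkQ) ?_
  simp only [← LinearMap.ker_eq_bot, LinearMap.ker_pi, Submodule.ker_mkQ, hE]

theorem finrank_quotient_comap_add_le [FiniteDimensional F Q] (f : P →ₗ[F] Q) (g : R →ₗ[F] Q)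
    (T : Submodule F Q) (h : ∀ x y, f x + g y ∈ T → y = 0) :
    finrank F (P ⧸ T.comap f) + finrank F R + finrank F T ≤ finrank F Q := by
  let φ : ((P ⧸ T.comap f) × R) →ₗ[F] Q ⧸ T :=
    ((T.comap f).mapQ T f le_rfl).coprod (T.mkQ ∘ₗ g)
  have hφ : LinearMap.ker φ = ⊥ := by
    rw [LinearMap.ker_eq_bot']
    rintro ⟨x, y⟩ hxy
    obtain ⟨x, rfl⟩ := (T.comap f).mkQ_surjective x
    have hT : f x + g y ∈ T := by
      rw [← Submodule.Quotient.mk_eq_zero]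
      exact hxy
    obtain rfl : y = 0 := h x y hT
    rw [map_zero, add_zero] at hT
    rw [Prod.mk_eq_zero]
    exact ⟨(Submodule.Quotient.mk_eq_zero _).2 hT, rfl⟩
  have hinj := LinearMap.ker_eq_bot.1 hφ
  have := Module.Finite.of_injective φ hinj
  have := Module.Finite.of_surjective (LinearMap.fst F (P ⧸ T.comap f) R) Prod.fst_surjective
  have := Module.Finite.of_surjective (LinearMap.snd F (P ⧸ T.comap f) R) Prod.snd_surjective
  have hle := LinearMap.finrank_le_finrank_of_injective hinj
  rw [finrank_prod] at hle
  have hQ := T.finrank_quotient_add_finrank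
  omega

theorem finrank_quotient_ker_add_le [FiniteDimensional F Q] (f : P →ₗ[F] Q) (g : R →ₗ[F] Q)
    (h : ∀ x y, f x + g y = 0 → y = 0) :
    finrank F (P ⧸ LinearMap.ker f) + finrank F R ≤ finrank F Q := by
  have hle := finrank_quotient_comap_add_le f g ⊥ h
  rw [finrank_bot, add_zero] at hle
  exact hle

end LinearAlgebra

/-! ### Global descriptions of coding solutions -/

namespace Network

variable {N : Network} {𝒜 : Type*} {k n : ℕ}

theorem edge_induction {p : N.Edge → Prop}
    (h : ∀ e, (∀ e', N.head e' = N.tail e → p e') → p e) (e : N.Edge) : p e := by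
  have := N.finite_node
  let r := Relation.TransGen fun u v => ∃ e, N.tail e = u ∧ N.head e = v
  have : Std.Irrefl r := ⟨N.acyclic⟩
  have hr : WellFounded r := Finite.wellFounded_of_trans_of_irrefl r
  induction hv : N.tail e using hr.induction generalizing e with
  | _ v ih =>
    subst hv
    exact h e fun e' he' => ih _ (.single ⟨e', rfl, he'⟩) e' rfl

theorem Code.Carries.unique {c : N.Code 𝒜 k n} {x : N.Msg → Fin k → 𝒜}
    {w w' : N.Edge → Fin n → 𝒜} (hw : c.Carries x w) (hw' : c.Carries x w') : w = w' := by
  funext e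
  induction e using edge_induction with
  | _ e ih =>
    have hin : N.inputsAt x w (N.tail e) = N.inputsAt x w' (N.tail e) :=
      Prod.ext (funext fun e' => ih e'.1 e'.2) rfl
    rw [hw e, hw' e, hin]

/-- The node `v` cannot distinguish the messages `x` from the messages `x'`, where `w y` are the
edge vectors for the messages `y`. -/
def SameInputs (w : (N.Msg → Fin k → 𝒜) → N.Edge → Fin n → 𝒜) (x x' : N.Msg → Fin k → 𝒜)
    (v : N.Node) : Prop :=
  N.inputsAt x (w x) v = N.inputsAt x' (w x') v

/-- A coding solution described by its global encoding functions: `w x` are the edge vectors for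
the messages `x`. Instead of naming the local functions at the nodes, one asks that every output
of a node is determined by the inputs of that node. -/
structure IsGlobalSolution (w : (N.Msg → Fin k → 𝒜) → N.Edge → Fin n → 𝒜) : Prop where
  edge_congr : ∀ ⦃x x'⦄ e, SameInputs w x x' (N.tail e) → w x e = w x' e
  demand_congr : ∀ ⦃x x'⦄ v, ∀ m ∈ N.demand v, SameInputs w x x' v → x m = x' m

theorem Code.IsSolution.exists_isGlobalSolution {c : N.Code 𝒜 k n} (hc : c.IsSolution) :
    ∃ w, (∀ x, c.Carries x (w x)) ∧ N.IsGlobalSolution w := by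
  choose w hw hdecode using hc
  refine ⟨w, hw, fun x x' e h => ?_, fun x x' v m hm h => ?_⟩
  · rw [hw x e, hw x' e, h]
  · rw [← hdecode x v m hm, ← hdecode x' v m hm, h]

theorem IsGlobalSolution.exists_isSolution [Nonempty 𝒜]
    {w : (N.Msg → Fin k → 𝒜) → N.Edge → Fin n → 𝒜} (hw : N.IsGlobalSolution w) :
    ∃ c : N.Code 𝒜 k n, c.IsSolution := by
  let inputs v x := N.inputsAt x (w x) v
  have hedge e : (fun x => w x e).FactorsThrough (inputs (N.tail e)) :=
    fun _ _ => hw.edge_congr e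
  have hdemand v m (hm : m ∈ N.demand v) :
      (fun x : N.Msg → Fin k → 𝒜 => x m).FactorsThrough (inputs v) :=
    fun _ _ => hw.demand_congr v m hm
  obtain ⟨edgeFn, hedgeFn⟩ := Classical.skolem.1 fun e =>
    (Function.factorsThrough_iff _).1 (hedge e)
  choose decodeFn hdecodeFn using fun v m hm => (Function.factorsThrough_iff _).1 (hdemand v m hm)
  exact ⟨⟨edgeFn, decodeFn⟩, fun x => ⟨w x, fun e => congrFun (hedgeFn e) x,
    fun v m hm => (congrFun (hdecodeFn v m hm) x).symm⟩⟩

section Linear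

variable {F : Type*} [Field F]

theorem Code.IsLinear.exists_isGlobalSolution {c : N.Code F k n} (hl : c.IsLinear)
    (hc : c.IsSolution) :
    ∃ w : (N.Msg → Fin k → F) →ₗ[F] N.Edge → Fin n → F, N.IsGlobalSolution w := by
  obtain ⟨w, hcarries, hw⟩ := hc.exists_isGlobalSolution
  have hadd x y : w (x + y) = w x + w y := by
    refine (hcarries (x + y)).unique fun e => ?_
    rw [Pi.add_apply, hcarries x e, hcarries y e, ← (hl.1 e).map_add]
    rfl
  have hsmul (r : F) x : w (r • x) = r • w x := by
    refine (hcarries (r • x)).unique fun e => ?_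
    rw [Pi.smul_apply, hcarries x e, ← (hl.1 e).map_smul]
    rfl
  exact ⟨⟨⟨w, hadd⟩, hsmul⟩, hw⟩

theorem IsGlobalSolution.exists_isLinear {w : (N.Msg → Fin k → F) →ₗ[F] N.Edge → Fin n → F}
    (hw : N.IsGlobalSolution w) : ∃ c : N.Code F k n, c.IsLinear ∧ c.IsSolution := by
  let inputs v : (N.Msg → Fin k → F) →ₗ[F] N.Inputs F k n v :=
    (LinearMap.funLeft F _ Subtype.val ∘ₗ w).prod (LinearMap.funLeft F _ Subtype.val)
  have hsame {v x} (hx : inputs v x = 0) : SameInputs w x 0 v := hx.trans (map_zero (inputs v)).symm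
  have hedge e : LinearMap.ker (inputs (N.tail e)) ≤ LinearMap.ker (LinearMap.proj e ∘ₗ w) :=
    fun x hx => (hw.edge_congr e (hsame hx)).trans (by rw [map_zero]; rfl)
  have hdemand v m (hm : m ∈ N.demand v) :
      LinearMap.ker (inputs v) ≤ LinearMap.ker (LinearMap.proj m) :=
    fun x hx => hw.demand_congr v m hm (hsame hx)
  choose edgeFn hedgeFn using fun e => exists_linearMap_comp_eq_of_ker_le_ker (hedge e)
  choose decodeFn hdecodeFn using fun v m hm =>
    exists_linearMap_comp_eq_of_ker_le_ker (hdemand v m hm)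
  exact ⟨⟨fun e => edgeFn e, fun v m hm => decodeFn v m hm⟩,
    ⟨fun e => (edgeFn e).isLinear, fun v m hm => (decodeFn v m hm).isLinear⟩,
    fun x => ⟨w x, fun e => (LinearMap.congr_fun (hedgeFn e) x).symm,
      fun v m hm => LinearMap.congr_fun (hdecodeFn v m hm) x⟩⟩

end Linear

end Network

namespace T8

open Node Network

/-! ### The bottleneck edges of the T8 network -/

theorem source_injective : Function.Injective source := by
  rintro ⟨⟩ ⟨⟩ h <;> first | rfl | cases h

theorem notMem_edges_source (u : Node) (m : Msg) : (u, source m) ∉ edges := by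
  cases m <;> simp [edges, source]

/-- The edge from `u` to `v`. -/
abbrev edge (u v : Node) (h : (u, v) ∈ edges := by decide) : network.Edge := ⟨(u, v), h⟩

section SameInputs

variable {𝒜 : Type*} {k n : ℕ} {w : (Msg → Fin k → 𝒜) → network.Edge → Fin n → 𝒜}
  {x x' : Msg → Fin k → 𝒜}

theorem sameInputs_iff {v : Node} :
    network.SameInputs w x x' v ↔
      (∀ u h, w x (edge u v h) = w x' (edge u v h)) ∧ ∀ m, source m = v → x m = x' m := by
  refine ⟨fun h => ⟨fun u hu => congrFun (congrArg Prod.fst h) ⟨edge u v hu, rfl⟩,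
    fun m hm => congrFun (congrArg Prod.snd h) ⟨m, hm⟩⟩, fun h => Prod.ext ?_ ?_⟩
  · funext ⟨⟨⟨u, v⟩, huv⟩, hv⟩
    subst hv
    exact h.1 u huv
  · exact funext fun m => h.2 m.1 m.2

theorem sameInputs_source {m : Msg} (hm : x m = x' m) : network.SameInputs w x x' (source m) := by
  refine sameInputs_iff.2 ⟨fun u hu => absurd hu (notMem_edges_source u m), fun m' hm' => ?_⟩
  rwa [source_injective hm']

theorem sameInputs_of_three_preds (hw : network.IsGlobalSolution w) {u₁ u₂ u₃ v : Node}
    (h₁ : network.SameInputs w x x' u₁) (h₂ : network.SameInputs w x x' u₂)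
    (h₃ : network.SameInputs w x x' u₃) (hsource : ∀ m, source m ≠ v := by decide)
    (hpred : ∀ u, (u, v) ∈ edges → u = u₁ ∨ u = u₂ ∨ u = u₃ := by decide) :
    network.SameInputs w x x' v := by
  refine sameInputs_iff.2 ⟨fun u hu => hw.edge_congr (edge u v hu) ?_,
    fun m hm => (hsource m hm).elim⟩
  rcases hpred u hu with rfl | rfl | rfl <;> assumption

theorem sameInputs_of_edge_eq {u v : Node} {huv : (u, v) ∈ edges}
    (h : w x (edge u v huv) = w x' (edge u v huv)) (hsource : ∀ m, source m ≠ v := by decide)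
    (hpred : ∀ u', (u', v) ∈ edges → u' = u := by decide) : network.SameInputs w x x' v := by
  refine sameInputs_iff.2 ⟨fun u' hu' => ?_, fun m hm => (hsource m hm).elim⟩
  obtain rfl := hpred u' hu'
  exact h

end SameInputs

/-- The functional dependencies that the T8 network imposes on the vectors `W`, `X`, `Y`, `Z`
carried by `(n3, n4)`, `(n5, n6)`, `(n7, n8)`, `(n1, n2)`, as functions of the messages. The demand
at `n13` is left out, since the bounds on the capacity do not draw on it. -/
structure IsBottleneck {M V : Type*} (W X Y Z : (Msg → M) → V) : Prop where
  W_congr : ∀ ⦃x x'⦄, x .B = x' .B → x .C = x' .C → x .D = x' .D → W x = W x'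
  X_congr : ∀ ⦃x x'⦄, x .A = x' .A → x .C = x' .C → x .D = x' .D → X x = X x'
  Z_congr : ∀ ⦃x x'⦄, x .A = x' .A → x .B = x' .B → x .C = x' .C → Z x = Z x'
  Y_congr : ∀ ⦃x x'⦄, W x = W x' → X x = X x' → Z x = Z x' → Y x = Y x'
  demand_n9 : ∀ ⦃x x'⦄, x .B = x' .B → x .D = x' .D → Y x = Y x' → x .A = x' .A
  demand_n10 : ∀ ⦃x x'⦄, x .A = x' .A → W x = W x' → Z x = Z x' → x .D = x' .D
  demand_n11 : ∀ ⦃x x'⦄, x .D = x' .D → Y x = Y x' → Z x = Z x' → x .C = x' .C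
  demand_n12 : ∀ ⦃x x'⦄, x .D = x' .D → X x = X x' → Z x = Z x' → x .B = x' .B
  demand_n14 : ∀ ⦃x x'⦄, x .A = x' .A → W x = W x' → Y x = Y x' → x .C = x' .C
  demand_n15 : ∀ ⦃x x'⦄, x .A = x' .A → W x = W x' → X x = X x' → x .B = x' .B

theorem isBottleneck_of_isGlobalSolution {𝒜 : Type*} {k n : ℕ}
    {w : (Msg → Fin k → 𝒜) → network.Edge → Fin n → 𝒜} (hw : network.IsGlobalSolution w) :
    IsBottleneck (fun x => w x (edge n3 n4)) (fun x => w x (edge n5 n6))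
      (fun x => w x (edge n7 n8)) (fun x => w x (edge n1 n2)) where
  W_congr _ _ hB hC hD := hw.edge_congr (edge n3 n4) <| sameInputs_of_three_preds hw
    (sameInputs_source hB) (sameInputs_source hC) (sameInputs_source hD)
  X_congr _ _ hA hC hD := hw.edge_congr (edge n5 n6) <| sameInputs_of_three_preds hw
    (sameInputs_source hA) (sameInputs_source hC) (sameInputs_source hD)
  Z_congr _ _ hA hB hC := hw.edge_congr (edge n1 n2) <| sameInputs_of_three_preds hw
    (sameInputs_source hA) (sameInputs_source hB) (sameInputs_source hC)
  Y_congr _ _ hW hX hZ := hw.edge_congr (edge n7 n8) <| sameInputs_of_three_preds hw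
    (sameInputs_of_edge_eq hW) (sameInputs_of_edge_eq hX) (sameInputs_of_edge_eq hZ)
  demand_n9 _ _ hB hD hY := hw.demand_congr n9 .A rfl <| sameInputs_of_three_preds hw
    (sameInputs_source hB) (sameInputs_source hD) (sameInputs_of_edge_eq hY)
  demand_n10 _ _ hA hW hZ := hw.demand_congr n10 .D rfl <| sameInputs_of_three_preds hw
    (sameInputs_source hA) (sameInputs_of_edge_eq hW) (sameInputs_of_edge_eq hZ)
  demand_n11 _ _ hD hY hZ := hw.demand_congr n11 .C rfl <| sameInputs_of_three_preds hw
    (sameInputs_source hD) (sameInputs_of_edge_eq hY) (sameInputs_of_edge_eq hZ)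
  demand_n12 _ _ hD hX hZ := hw.demand_congr n12 .B rfl <| sameInputs_of_three_preds hw
    (sameInputs_source hD) (sameInputs_of_edge_eq hX) (sameInputs_of_edge_eq hZ)
  demand_n14 _ _ hA hW hY := hw.demand_congr n14 .C rfl <| sameInputs_of_three_preds hw
    (sameInputs_source hA) (sameInputs_of_edge_eq hW) (sameInputs_of_edge_eq hY)
  demand_n15 _ _ hA hW hX := hw.demand_congr n15 .B rfl <| sameInputs_of_three_preds hw
    (sameInputs_source hA) (sameInputs_of_edge_eq hW) (sameInputs_of_edge_eq hX)

namespace IsBottleneck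

variable {M V : Type*} {W X Y Z : (Msg → M) → V}

theorem injective_Y_update (h : IsBottleneck W X Y Z) (x : Msg → M) :
    Function.Injective fun a => Y (Function.update x .A a) := fun a a' haa' => by
  simpa using h.demand_n9 (by simp) (by simp) haa'

theorem injective_Z_update (h : IsBottleneck W X Y Z) (x : Msg → M) :
    Function.Injective fun b => Z (Function.update x .B b) := fun b b' hbb' => by
  simpa using h.demand_n12 (by simp) (h.X_congr (by simp) (by simp) (by simp)) hbb'

theorem injective_W_update (h : IsBottleneck W X Y Z) (x : Msg → M) :
    Function.Injective fun d => W (Function.update x .D d) := fun d d' hdd' => by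
  simpa using h.demand_n10 (by simp) hdd' (h.Z_congr (by simp) (by simp) (by simp))

end IsBottleneck

/-! ### The rank inequality -/

open Module

section Alignment

variable {F U V ι : Type*} [Field F] [AddCommGroup U] [Module F U] [AddCommGroup V] [Module F V]
  [DecidableEq ι]

variable (F U) in
/-- The projection of `ι → U` onto the tuples supported at `i`. It isolates the part of a tuple of
messages that comes from one message. -/
def component (i : ι) : (ι → U) →ₗ[F] ι → U :=
  LinearMap.single F (fun _ => U) i ∘ₗ LinearMap.proj i

/-- The tuples of messages whose components at `i` and `j` have the same images under `S`, and the
same images under `T`. -/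
def aligned (S T : (ι → U) →ₗ[F] V) (i j : ι) : Submodule F (ι → U) :=
  LinearMap.ker (S.prod T ∘ₗ (component F U i - component F U j))

/-- The tuples of messages whose component at `i` can be aligned, for `S` and `T` simultaneously,
with some tuple supported at `j`; unlike in `aligned`, that tuple need not be their own component
at `j`. -/
def alignable (S T : (ι → U) →ₗ[F] V) (i j : ι) : Submodule F (ι → U) :=
  (LinearMap.range (S.prod T ∘ₗ LinearMap.single F (fun _ => U) j)).comap
    (S.prod T ∘ₗ component F U i)

variable {S T : (ι → U) →ₗ[F] V} {i j l p : ι} {x : ι → U}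

theorem mem_aligned : x ∈ aligned S T i j ↔
    S (Pi.single i (x i)) = S (Pi.single j (x j)) ∧
      T (Pi.single i (x i)) = T (Pi.single j (x j)) := by
  simp [aligned, component, sub_eq_zero]

theorem mem_alignable : x ∈ alignable S T i j ↔
    ∃ u, S (Pi.single j u) = S (Pi.single i (x i)) ∧
      T (Pi.single j u) = T (Pi.single i (x i)) := by
  simp [alignable, component]

variable [FiniteDimensional F V]

theorem finrank_quotient_aligned_add_le
    (hdecode : ∀ ⦃x x'⦄, x p = x' p → S x = S x' → T x = T x' → x l = x' l)
    (hip : i ≠ p := by decide) (hjp : j ≠ p := by decide) (hlp : l ≠ p := by decide)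
    (hil : i ≠ l := by decide) (hjl : j ≠ l := by decide) :
    finrank F ((ι → U) ⧸ aligned S T i j) + finrank F U ≤ 2 * finrank F V := by
  have hle := finrank_quotient_ker_add_le (S.prod T ∘ₗ (component F U i - component F U j))
    (S.prod T ∘ₗ LinearMap.single F (fun _ => U) l) fun x y hxy => by
      let z := component F U i x - component F U j x + Pi.single l y
      have hz : S.prod T z = 0 := (map_add _ _ _).trans hxy
      have hzl : z l = 0 := hdecode (x' := 0) (by simp [z, component, *, Ne.symm])
        (by simpa using congrArg Prod.fst hz) (by simpa using congrArg Prod.snd hz)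
      simpa [z, component, hil.symm, hjl.symm] using hzl
  rwa [finrank_prod, ← two_mul] at hle

theorem finrank_quotient_alignable_add_le
    (hdecode : ∀ ⦃x x'⦄, x p = x' p → S x = S x' → T x = T x' → x l = x' l)
    (hinj : Function.Injective (S.prod T ∘ₗ LinearMap.single F (fun _ => U) j))
    (hip : i ≠ p := by decide) (hjp : j ≠ p := by decide) (hlp : l ≠ p := by decide)
    (hil : i ≠ l := by decide) (hjl : j ≠ l := by decide) :
    finrank F ((ι → U) ⧸ alignable S T i j) + 2 * finrank F U ≤ 2 * finrank F V := by
  have hle := finrank_quotient_comap_add_le (S.prod T ∘ₗ component F U i)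
    (S.prod T ∘ₗ LinearMap.single F (fun _ => U) l)
    (LinearMap.range (S.prod T ∘ₗ LinearMap.single F (fun _ => U) j)) fun x y hxy => by
      obtain ⟨u, hu⟩ := hxy
      have hST : S.prod T (component F U i x + Pi.single l y) = S.prod T (Pi.single j u) :=
        (map_add _ _ _).trans hu.symm
      simpa [component, hil.symm, hjl.symm] using
        hdecode (by simp [component, *, Ne.symm]) (congrArg Prod.fst hST) (congrArg Prod.snd hST)
  rw [LinearMap.finrank_range_of_inj hinj, finrank_prod] at hle
  change finrank F ((ι → U) ⧸ alignable S T i j) + _ + _ ≤ _ at hle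
  omega

end Alignment

namespace IsBottleneck

variable {F U V : Type*} [Field F] [AddCommGroup U] [Module F U] [AddCommGroup V] [Module F V]
  {W X Y Z : (Msg → U) →ₗ[F] V}

theorem injective_Y_single (h : IsBottleneck W X Y Z) :
    Function.Injective fun a => Y (Pi.single .A a) := h.injective_Y_update 0

theorem injective_Z_single (h : IsBottleneck W X Y Z) :
    Function.Injective fun b => Z (Pi.single .B b) := h.injective_Z_update 0

theorem injective_W_single (h : IsBottleneck W X Y Z) :
    Function.Injective fun d => W (Pi.single .D d) := h.injective_W_update 0

theorem finrank_le [FiniteDimensional F V] (h : IsBottleneck W X Y Z) :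
    finrank F U ≤ finrank F V :=
  LinearMap.finrank_le_finrank_of_injective
    (f := Y ∘ₗ LinearMap.single F (fun _ => U) Msg.A) h.injective_Y_single

theorem three_smul_Y_single_eq_zero (h : IsBottleneck W X Y Z) {a b c d : U}
    (hWb : W (Pi.single .B b) = W (Pi.single .C c)) (hWd : W (Pi.single .C c) = W (Pi.single .D d))
    (hXa : X (Pi.single .A a) = X (Pi.single .C c)) (hXd : X (Pi.single .C c) = X (Pi.single .D d))
    (hZa : Z (Pi.single .A a) = Z (Pi.single .C c)) (hZb : Z (Pi.single .B b) = Z (Pi.single .C c))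
    (hYa : Y (Pi.single .B b) = Y (Pi.single .A a)) (hYd : Y (Pi.single .D d) = Y (Pi.single .B b))
    (hYc : Y (Pi.single .C c) = 0) : (3 : F) • Y (Pi.single .A a) = 0 := by
  have hWa : W (Pi.single .A a) = W 0 := h.W_congr (by simp) (by simp) (by simp)
  have hXb : X (Pi.single .B b) = X 0 := h.X_congr (by simp) (by simp) (by simp)
  have hZd : Z (Pi.single .D d) = Z 0 := h.Z_congr (by simp) (by simp) (by simp)
  let y : Msg → U := Pi.single Msg.A a + Pi.single Msg.B b + Pi.single Msg.D d -
    2 • (Pi.single Msg.C c : Msg → U)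
  have hY : Y y = Y 0 := by
    apply h.Y_congr <;> simp only [y, map_add, map_sub, map_nsmul]
    · rw [hWa, hWb, ← hWd, map_zero]; module
    · rw [hXa, hXb, ← hXd, map_zero]; module
    · rw [hZa, hZb, hZd, map_zero]; module
  calc (3 : F) • Y (Pi.single .A a) = Y y := by
        simp only [y, map_add, map_sub, map_nsmul, hYa, hYd, hYc]; module
    _ = 0 := by rw [hY, map_zero]

theorem eq_zero_of_aligned (h3 : (3 : F) ≠ 0) (h : IsBottleneck W X Y Z) {x : Msg → U}
    (hWZ : x ∈ aligned W Z .B .C) (hXZ : x ∈ aligned X Z .A .C) (hWX : x ∈ aligned W X .C .D)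
    (hYZ : x ∈ alignable Y Z .A .B) (hWY : x ∈ alignable W Y .B .D)
    (hY : Y (Pi.single .C (x .C)) = 0) : x = 0 := by
  obtain ⟨hWb, hZb⟩ := mem_aligned.1 hWZ
  obtain ⟨hXa, hZa⟩ := mem_aligned.1 hXZ
  obtain ⟨hWd, hXd⟩ := mem_aligned.1 hWX
  obtain ⟨b, hYa, hZb'⟩ := mem_alignable.1 hYZ
  obtain rfl : b = x .B := h.injective_Z_single (hZb'.trans (hZa.trans hZb.symm))
  obtain ⟨d, hWd', hYd⟩ := mem_alignable.1 hWY
  obtain rfl : d = x .D := h.injective_W_single (hWd'.trans (hWb.trans hWd))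
  have hA : x .A = 0 := h.injective_Y_single <| by
    have hYA := h.three_smul_Y_single_eq_zero hWb hWd hXa hXd hZa hZb hYa hYd hY
    simpa using (smul_eq_zero.1 hYA).resolve_left h3
  have hZc : Z (Pi.single .C (x .C)) = 0 := by rw [← hZa, hA, Pi.single_zero, map_zero]
  have hC : x .C = 0 := by
    simpa using h.demand_n11 (x := Pi.single .C (x .C)) (x' := 0) (by simp) (by simpa) (by simpa)
  have hB : x .B = 0 := h.injective_Z_single <| by
    simpa using hZb.trans hZc
  have hD : x .D = 0 := h.injective_W_single <| by
    rw [hC, Pi.single_zero, map_zero] at hWd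
    simpa using hWd.symm
  ext m
  cases m <;> assumption

theorem twelve_mul_finrank_le [FiniteDimensional F V] (h3 : (3 : F) ≠ 0)
    (h : IsBottleneck W X Y Z) : 12 * finrank F U ≤ 11 * finrank F V := by
  have : FiniteDimensional F U := .of_injective (Y ∘ₗ LinearMap.single F (fun _ => U) Msg.A)
    h.injective_Y_single
  let E : Fin 6 → Submodule F (Msg → U) := ![aligned W Z .B .C, aligned X Z .A .C,
    aligned W X .C .D, alignable Y Z .A .B, alignable W Y .B .D,
    LinearMap.ker (Y ∘ₗ component F U .C)]
  have hE : ⨅ i, E i = ⊥ := by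
    refine (Submodule.eq_bot_iff _).2 fun x hx => ?_
    rw [Submodule.mem_iInf] at hx
    exact h.eq_zero_of_aligned h3 (hx 0) (hx 1) (hx 2) (hx 3) (hx 4) (hx 5)
  have hWZ := finrank_quotient_aligned_add_le (i := Msg.B) (j := Msg.C) h.demand_n10
  have hXZ := finrank_quotient_aligned_add_le (i := Msg.A) (j := Msg.C) h.demand_n12
  have hWX := finrank_quotient_aligned_add_le (i := Msg.C) (j := Msg.D) h.demand_n15
  have hYZ := finrank_quotient_alignable_add_le (i := Msg.A) (j := Msg.B) h.demand_n11
    fun _ _ huv => h.injective_Z_single (congrArg Prod.snd huv)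
  have hWY := finrank_quotient_alignable_add_le (i := Msg.B) (j := Msg.D) h.demand_n14
    fun _ _ huv => h.injective_W_single (congrArg Prod.fst huv)
  have hY := finrank_quotient_ker_add_le (Y ∘ₗ component F U .C)
    (Y ∘ₗ LinearMap.single F (fun _ => U) .A) fun x a hxa => by
      have ha := h.demand_n9 (x := component F U .C x + Pi.single .A a) (x' := 0)
        (by simp [component]) (by simp [component]) (by simpa using hxa)
      simpa [component] using ha
  have hsum := finrank_le_sum_finrank_quotient hE
  rw [Fin.sum_univ_six, finrank_pi_fintype, Finset.sum_const, Finset.card_univ] at hsum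
  change 4 * finrank F U ≤ finrank F (_ ⧸ aligned W Z .B .C) +
    finrank F (_ ⧸ aligned X Z .A .C) + finrank F (_ ⧸ aligned W X .C .D) +
    finrank F (_ ⧸ alignable Y Z .A .B) + finrank F (_ ⧸ alignable W Y .B .D) +
    finrank F (_ ⧸ LinearMap.ker (Y ∘ₗ component F U .C)) at hsum
  omega

end IsBottleneck

/-! ### The solution by sums -/

section NodeSum

/-- The messages whose sum a node sends on its out-edges, in the solution over an abelian group of
exponent `3`. -/
def summands : Node → Finset Msg
  | sA => {.A}
  | sB => {.B}
  | sC => {.C}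
  | sD => {.D}
  | n1 | n2 => {.A, .B, .C}
  | n3 | n4 => {.B, .C, .D}
  | n5 | n6 => {.A, .C, .D}
  | n7 | n8 => {.A, .B, .D}
  | _ => ∅

variable {G : Type*} [AddCommGroup G]

/-- The group element that the node `v` sends on its out-edges when the messages are `y`. -/
def nodeSum (y : Msg → G) (v : Node) : G :=
  ∑ m ∈ summands v, y m

variable {y : Msg → G} {v : Node}

theorem nodeSum_eq_zero (h3 : ∀ g : G, 3 • g = 0)
    (hpred : ∀ u, (u, v) ∈ edges → nodeSum y u = 0) (hsource : ∀ m, source m = v → y m = 0) :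
    nodeSum y v = 0 := by
  cases v
  case n7 =>
    have hW : y .B + y .C + y .D = 0 := by
      simpa [nodeSum, summands, add_assoc] using hpred n4 (by decide)
    have hX : y .A + y .C + y .D = 0 := by
      simpa [nodeSum, summands, add_assoc] using hpred n6 (by decide)
    have hZ : y .A + y .B + y .C = 0 := by
      simpa [nodeSum, summands, add_assoc] using hpred n2 (by decide)
    have hY : y .A + y .B + y .D = 0 := by
      linear_combination (norm := module) h3 (y .A + y .B + y .C + y .D) - hW - hX - hZ
    simpa [nodeSum, summands, add_assoc] using hY
  all_goals simp_all [nodeSum, summands, edges, source]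

theorem eq_zero_of_mem_demand (hpred : ∀ u, (u, v) ∈ edges → nodeSum y u = 0) {m : Msg}
    (hm : m ∈ demand v) : y m = 0 := by
  have hA (h : (sA, v) ∈ edges) : y .A = 0 := by simpa [nodeSum, summands] using hpred _ h
  have hB (h : (sB, v) ∈ edges) : y .B = 0 := by simpa [nodeSum, summands] using hpred _ h
  have hD (h : (sD, v) ∈ edges) : y .D = 0 := by simpa [nodeSum, summands] using hpred _ h
  have hW (h : (n4, v) ∈ edges) : y .B + y .C + y .D = 0 := by
    simpa [nodeSum, summands, add_assoc] using hpred _ h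
  have hX (h : (n6, v) ∈ edges) : y .A + y .C + y .D = 0 := by
    simpa [nodeSum, summands, add_assoc] using hpred _ h
  have hY (h : (n8, v) ∈ edges) : y .A + y .B + y .D = 0 := by
    simpa [nodeSum, summands, add_assoc] using hpred _ h
  have hZ (h : (n2, v) ∈ edges) : y .A + y .B + y .C = 0 := by
    simpa [nodeSum, summands, add_assoc] using hpred _ h
  cases v <;> try exact hm.elim
  case n9 =>
    obtain rfl : m = .A := hm
    linear_combination (norm := module) hY (by decide) - hB (by decide) - hD (by decide)
  case n10 =>
    obtain rfl : m = .D := hm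
    linear_combination (norm := module) hW (by decide) - hZ (by decide) + hA (by decide)
  case n11 =>
    obtain rfl : m = .C := hm
    linear_combination (norm := module) hZ (by decide) - hY (by decide) + hD (by decide)
  case n12 =>
    obtain rfl : m = .B := hm
    linear_combination (norm := module) hZ (by decide) - hX (by decide) + hD (by decide)
  case n13 =>
    obtain rfl : m = .C := hm
    linear_combination (norm := module) hX (by decide) - hY (by decide) + hB (by decide)
  case n14 =>
    obtain rfl : m = .C := hm
    linear_combination (norm := module) hW (by decide) - hY (by decide) + hA (by decide)
  case n15 =>
    obtain rfl : m = .B := hm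
    linear_combination (norm := module) hW (by decide) - hX (by decide) + hA (by decide)

theorem isGlobalSolution_nodeSum {𝒜 : Type*} {k n : ℕ} (h3 : ∀ g : G, 3 • g = 0)
    {enc : (Fin k → 𝒜) → G} (henc : Function.Injective enc) {put : G → Fin n → 𝒜}
    (hput : Function.Injective put) :
    network.IsGlobalSolution fun x e => put (nodeSum (fun m => enc (x m)) (network.tail e)) := by
  let w : (Msg → Fin k → 𝒜) → network.Edge → Fin n → 𝒜 :=
    fun x e => put (nodeSum (fun m => enc (x m)) e.1.1)
  have nodeSum_sub (y y' : Msg → G) v : nodeSum (y - y') v = nodeSum y v - nodeSum y' v :=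
    Finset.sum_sub_distrib y y'
  have hpred {x x' v} (h : network.SameInputs w x x' v) u (hu : (u, v) ∈ edges) :
      nodeSum ((fun m => enc (x m)) - fun m => enc (x' m)) u = 0 := by
    rw [nodeSum_sub, hput ((sameInputs_iff.1 h).1 u hu), sub_self]
  refine ⟨fun x x' e h => congrArg put ?_, fun x x' v m hm h => henc ?_⟩
  · rw [← sub_eq_zero, ← nodeSum_sub]
    refine nodeSum_eq_zero h3 (hpred h) fun m hm => ?_
    rw [Pi.sub_apply, (sameInputs_iff.1 h).2 m hm, sub_self]
  · exact sub_eq_zero.1 (eq_zero_of_mem_demand (hpred h) hm)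

end NodeSum

theorem exists_isSolution (𝒜 : Type*) [Finite 𝒜] [Nontrivial 𝒜] (k : ℕ) :
    ∃ c : network.Code 𝒜 k (k + 2), c.IsSolution := by
  let q := Nat.card 𝒜
  have hq : 1 < q := Finite.one_lt_card
  obtain ⟨m, hput, hlt⟩ : ∃ m, 3 ^ m ≤ q ^ (k + 2) ∧ q ^ (k + 2) < 3 ^ (m + 1) :=
    exists_nat_pow_near (Nat.one_le_pow _ _ hq.le) (by norm_num)
  have henc : q ^ k ≤ 3 ^ m := by
    have hq4 : q ^ k * 2 ^ 2 ≤ q ^ (k + 2) := by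
      rw [pow_add]
      gcongr
      exact hq
    rw [pow_succ 3 m] at hlt
    omega
  have := Fintype.ofFinite 𝒜
  obtain ⟨enc⟩ : Nonempty ((Fin k → 𝒜) ↪ (Fin m → ZMod 3)) :=
    Function.Embedding.nonempty_of_card_le (by simpa [q] using henc)
  obtain ⟨put⟩ : Nonempty ((Fin m → ZMod 3) ↪ (Fin (k + 2) → 𝒜)) :=
    Function.Embedding.nonempty_of_card_le (by simpa [q] using hput)
  have h3 (g : Fin m → ZMod 3) : 3 • g = 0 := by
    rw [← Nat.cast_smul_eq_nsmul (ZMod 3), ZMod.natCast_self, zero_smul]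
  exact (isGlobalSolution_nodeSum h3 enc.injective put.injective).exists_isSolution

theorem exists_isLinear_isSolution (F : Type*) [Field F] [CharP F 3] (k : ℕ) :
    ∃ c : network.Code F k k, c.IsLinear ∧ c.IsSolution := by
  let w : (Msg → Fin k → F) →ₗ[F] network.Edge → Fin k → F :=
    LinearMap.pi fun e => ∑ m ∈ summands (network.tail e), LinearMap.proj m
  have hw : ⇑w = fun x e => nodeSum x (network.tail e) := by
    funext x e
    simp [w, nodeSum]
  have h3 (g : Fin k → F) : 3 • g = 0 := by
    rw [← Nat.cast_smul_eq_nsmul F, CharP.cast_eq_zero, zero_smul]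
  have hsol : network.IsGlobalSolution w := by
    rw [hw]
    exact isGlobalSolution_nodeSum h3 Function.injective_id Function.injective_id
  exact hsol.exists_isLinear

/-! ### Capacities -/

theorem le_of_isSolution {𝒜 : Type*} [Finite 𝒜] [Nontrivial 𝒜] {k n : ℕ} {c : network.Code 𝒜 k n}
    (hc : c.IsSolution) : k ≤ n := by
  obtain ⟨w, -, hw⟩ := hc.exists_isGlobalSolution
  obtain ⟨x⟩ : Nonempty (Msg → Fin k → 𝒜) := inferInstance
  have hcard := Nat.card_le_card_of_injective _
    ((isBottleneck_of_isGlobalSolution hw).injective_Y_update x)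
  rw [Nat.card_fun, Nat.card_fun, Nat.card_fin, Nat.card_fin] at hcard
  exact (Nat.pow_le_pow_iff_right Finite.one_lt_card).1 hcard

theorem codingCapacityOver_eq_one (𝒜 : Type*) [Finite 𝒜] [Nontrivial 𝒜] :
    network.codingCapacityOver 𝒜 = 1 := by
  refine le_antisymm (sSup_le ?_) (one_le_of_forall_natCast_div_le fun k hk => le_sSup ?_)
  · rintro _ ⟨k, n, -, -, ⟨c, hc⟩, rfl⟩
    exact natCast_div_le_one (le_of_isSolution hc)
  · exact ⟨k, k + 2, hk, by omega, exists_isSolution 𝒜 k, rfl⟩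

theorem codingCapacity_eq_one : network.codingCapacity = 1 := by
  refine le_antisymm (sSup_le ?_) ?_
  · rintro _ ⟨𝒜, _, _, k, n, -, -, ⟨c, hc⟩, rfl⟩
    exact natCast_div_le_one (le_of_isSolution hc)
  · rw [← codingCapacityOver_eq_one Bool]
    refine sSup_le_sSup ?_
    rintro _ ⟨k, n, h⟩
    exact ⟨Bool, inferInstance, inferInstance, k, n, h⟩

theorem exists_isBottleneck_of_isLinear {F : Type*} [Field F] {k n : ℕ} {c : network.Code F k n}
    (hl : c.IsLinear) (hc : c.IsSolution) :
    ∃ W X Y Z : (Msg → Fin k → F) →ₗ[F] Fin n → F, IsBottleneck W X Y Z := by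
  obtain ⟨w, hw⟩ := hl.exists_isGlobalSolution hc
  exact ⟨LinearMap.proj _ ∘ₗ w, LinearMap.proj _ ∘ₗ w, LinearMap.proj _ ∘ₗ w,
    LinearMap.proj _ ∘ₗ w, isBottleneck_of_isGlobalSolution hw⟩

theorem linearCapacityOver_eq_one (F : Type*) [Field F] [CharP F 3] :
    network.linearCapacityOver F = 1 := by
  refine le_antisymm (sSup_le ?_) (le_sSup ?_)
  · rintro _ ⟨k, n, -, -, ⟨c, hl, hc⟩, rfl⟩
    obtain ⟨W, X, Y, Z, h⟩ := exists_isBottleneck_of_isLinear hl hc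
    exact natCast_div_le_one (by simpa using h.finrank_le)
  · exact ⟨1, 1, one_pos, one_pos, exists_isLinear_isSolution F 1, by simp⟩

theorem linearCapacityOver_le (F : Type*) [Field F] (hF : ¬ CharP F 3) :
    network.linearCapacityOver F ≤ 11 / 12 := by
  have h3 : (3 : F) ≠ 0 := mt (CharP.charP_iff_prime_eq_zero Nat.prime_three).2 hF
  refine sSup_le ?_
  rintro _ ⟨k, n, -, -, ⟨c, hl, hc⟩, rfl⟩
  obtain ⟨W, X, Y, Z, h⟩ := exists_isBottleneck_of_isLinear hl hc
  have hle : 12 * k ≤ 11 * n := by simpa using h.twelve_mul_finrank_le h3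
  exact_mod_cast natCast_div_le_natCast_div (c := 11) (d := 12) (by norm_num) (by lia)

end T8

theorem mainTheorem3_general :
    (∀ (F : Type*) [Field F], ¬ CharP F 3 → T8.network.linearCapacityOver F ≤ 11 / 12) ∧
    (∀ (F : Type*) [Field F], CharP F 3 → T8.network.linearCapacityOver F = 1) ∧
    (∀ (𝒜 : Type*) [Finite 𝒜] [Nontrivial 𝒜], T8.network.codingCapacityOver 𝒜 = 1) ∧
    T8.network.codingCapacity = 1 :=
  ⟨fun F _ => T8.linearCapacityOver_le F, fun F _ _ => T8.linearCapacityOver_eq_one F,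
    fun 𝒜 _ _ => T8.codingCapacityOver_eq_one 𝒜, T8.codingCapacity_eq_one⟩

theorem mainTheorem3 :
    (∀ (F : Type*) [Field F] [Finite F], ¬ CharP F 3 →
      T8.network.linearCapacityOver F ≤ 48 / 49) ∧
    (∀ (F : Type*) [Field F] [Finite F], CharP F 3 →
      T8.network.linearCapacityOver F = 1) ∧
    (∀ (𝒜 : Type*) [Finite 𝒜] [Nontrivial 𝒜], T8.network.codingCapacityOver 𝒜 = 1) ∧
    T8.network.codingCapacity = 1 := by
  have hbound : (11 / 12 : ℝ≥0∞) ≤ 48 / 49 := by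
    exact_mod_cast natCast_div_le_natCast_div (a := 11) (b := 12) (c := 48) (d := 49)
      (by norm_num) (by norm_num)
  obtain ⟨hle, heq, hover, hcap⟩ := mainTheorem3_general
  exact ⟨fun F _ _ hF => (hle F hF).trans hbound, fun F _ _ => heq F, hover, hcap⟩
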